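/- Let $\mathbb{R}^n$ ($n\ge 1$) carry its Euclidean structure, let $K\subset\mathbb{R}^n$ be a centrally-symmetric convex body (a compact convex set with non-empty interior and $K=-K$), and let $\|\cdot\|_K$ be the norm with unit ball $K$. For $0<\varepsilon\le 2$ put \[ \delta_K(\varepsilon)=\inf\Bigl\{1-\Bigl\|\frac{x+y}{2}\Bigr\|_K \;:\; \|x\|_K\le 1,\ \|y\|_K\le 1,\ \|x-y\|_K\ge\varepsilon\Bigr\}, \] and, for $\alpha>0$, call $K$ 2-convex with constant $\alpha$ if $\delta_K(\varepsilon)\ge\alpha\varepsilon^2$ for all $0<\varepsilon\le 2$. A set $\tilde K\subset\mathbb{R}^n$ of volume one is isotropic with constant $L\ge 0$ if $\int_{\tilde K}\langle x,\theta\rangle^2\,dx=L^2|\theta|^2$ for all $\theta\in\mathbb{R}^n$; the isotropic constant $L_K$ of $K$ is this number $L$ for an isotropic image $\tilde K=T(K)$ of $K$ under an invertible linear map $T$. There are universal constants $c,C>0$ such that for every $n\ge 1$, every $\alpha>0$ and every centrally-symmetric convex body $K\subset\mathbb{R}^n$ of volume one that is 2-convex with constant $\alpha$: (a) there exists an affine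 hyperplane $H\subset\mathbb{R}^n$ with $\mathrm{Vol}_{n-1}(K\cap H)\ge c\sqrt{\alpha}$; (b) $K$ has an invertible linear image that is isotropic, and $L_K\le C/\sqrt{\alpha}$ (for every such image). -/

import Mathlib

open MeasureTheory

namespace TwoConvexBody

/-- A centrally-symmetric convex body in `ℝⁿ`: a compact convex set with non-empty interior
such that `K = -K`. -/
structure IsSymmConvexBody {n : ℕ} (K : Set (EuclideanSpace ℝ (Fin n))) : Prop where
  convex : Convex ℝ K
  isCompact : IsCompact K
  interior_nonempty : (interior K).Nonempty
  neg_mem : ∀ x ∈ K, -x ∈ K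

/-- The modulus of convexity
`δ_K(ε) = inf {1 - ‖(x + y) / 2‖_K : ‖x‖_K ≤ 1, ‖y‖_K ≤ 1, ‖x - y‖_K ≥ ε}`,
where the norm `‖·‖_K` with unit ball `K` is the Minkowski functional `gauge K`. -/
noncomputable def modulusOfConvexity {n : ℕ} (K : Set (EuclideanSpace ℝ (Fin n))) (ε : ℝ) : ℝ :=
  sInf {d : ℝ | ∃ x y : EuclideanSpace ℝ (Fin n), gauge K x ≤ 1 ∧ gauge K y ≤ 1 ∧
    ε ≤ gauge K (x - y) ∧ d = 1 - gauge K ((1 / 2 : ℝ) • (x + y))}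

/-- `K` is 2-convex with constant `α`: `δ_K(ε) ≥ α ε²` for all `0 < ε ≤ 2`. -/
def IsTwoConvex {n : ℕ} (K : Set (EuclideanSpace ℝ (Fin n))) (α : ℝ) : Prop :=
  ∀ ε : ℝ, 0 < ε → ε ≤ 2 → α * ε ^ 2 ≤ modulusOfConvexity K ε

/-- `K` has volume one and is in isotropic position with isotropic constant `L ≥ 0`:
`∫_K ⟨x, θ⟩² dx = L² |θ|²` for every `θ`. -/
def IsIsotropicWith {n : ℕ} (K : Set (EuclideanSpace ℝ (Fin n))) (L : ℝ) : Prop :=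
  volume K = 1 ∧ 0 ≤ L ∧
    ∀ θ : EuclideanSpace ℝ (Fin n), ∫ x in K, (inner ℝ x θ) ^ 2 = L ^ 2 * ‖θ‖ ^ 2

/-- `L` is the isotropic constant `L_K` of `K`: some invertible linear image of `K` is in
isotropic position with isotropic constant `L`. -/
def HasIsotropicConstant {n : ℕ} (K : Set (EuclideanSpace ℝ (Fin n))) (L : ℝ) : Prop :=
  ∃ T : EuclideanSpace ℝ (Fin n) ≃ₗ[ℝ] EuclideanSpace ℝ (Fin n), IsIsotropicWith (T '' K) L

end TwoConvexBody

namespace TwoConvexBody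

open scoped ENNReal Pointwise Topology Matrix MatrixOrder

/-! One good direction suffices. A body of volume one cannot contain the cube `[-1,1]ⁿ`, so it
misses a point of norm at most `√n`; separating that point gives a unit `θ` with `⟨x,θ⟩ ≤ √n` on `K`
(`exists_inner_le_sqrt`). Let `A` be the half of `K` where `⟨x,θ⟩ ≤ 0` and `B` the cap where `⟨x,θ⟩
≥ t`. Points of `A` and `B` are at `K`-distance at least `ε = t/√n`, so 2-convexity puts their
midpoints in `exp(-αε²) K`. Brunn–Minkowski gives `|A||B| ≤ exp(-2αnε²) = exp(-2αt²)`: the dimension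
cancels, and `⟨·,θ⟩` has a Gaussian tail (`volume_le_inner_le`). For (a), a slab of width of order
`1/√α` then carries more than a fixed share of the volume, and Fubini finds a large section. For
(b), the tail bounds the second moment along `θ` by `2/α`; 2-convexity is linearly invariant, so
this applies in isotropic position, where that moment is `L²`. -/

/-! ### Prékopa–Leindler and Brunn–Minkowski for midpoints. -/

/-- The translates `A + min B` and `max A + B` both lie in `2S` and meet only at `max A + min B`. -/
lemma volume_add_volume_le_of_isCompact {A B S : Set ℝ} (hA : IsCompact A) (hB : IsCompact B)
    (hA' : A.Nonempty) (hB' : B.Nonempty)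
    (h : ∀ a ∈ A, ∀ b ∈ B, (1 / 2 : ℝ) * (a + b) ∈ S) :
    volume A + volume B ≤ 2 * volume S := by
  set m := sSup A
  set k := sInf B
  have hm : m ∈ A := hA.sSup_mem hA'
  have hk : k ∈ B := hB.sInf_mem hB'
  have hsub : ((k + ·) '' A) ∪ ((m + ·) '' B) ⊆ (2 : ℝ) • S := by
    rintro _ (⟨a, ha, rfl⟩ | ⟨b, hb, rfl⟩)
    · exact ⟨_, h a ha k hk, by simp; ring⟩
    · exact ⟨_, h m hm b hb, by simp⟩
  have hdisj : AEDisjoint volume ((k + ·) '' A) ((m + ·) '' B) := by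
    refine measure_mono_null (t := {m + k}) ?_ (by simp)
    rintro _ ⟨⟨a, ha, rfl⟩, ⟨b, hb, hab⟩⟩
    have h1 : a ≤ m := le_csSup hA.bddAbove ha
    have h2 : k ≤ b := csInf_le hB.bddBelow hb
    simp only [Set.mem_singleton_iff] at hab ⊢
    linarith
  have hmeas : MeasurableSet ((m + ·) '' B) :=
    (hB.image (continuous_const_add m)).measurableSet
  calc volume A + volume B = volume ((k + ·) '' A) + volume ((m + ·) '' B) := by
        simp [measure_preimage_add]
    _ = volume (((k + ·) '' A) ∪ ((m + ·) '' B)) :=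
        (measure_union₀ hmeas.nullMeasurableSet hdisj).symm
    _ ≤ volume ((2 : ℝ) • S) := measure_mono hsub
    _ = 2 * volume S := by simp [Measure.addHaar_smul]

/-- The one-dimensional Brunn–Minkowski inequality for the midpoint sum. -/
lemma volume_add_volume_le {A B S : Set ℝ} (hA : MeasurableSet A) (hB : MeasurableSet B)
    (hA' : A.Nonempty) (hB' : B.Nonempty)
    (h : ∀ a ∈ A, ∀ b ∈ B, (1 / 2 : ℝ) * (a + b) ∈ S) :
    volume A + volume B ≤ 2 * volume S := by
  obtain ⟨a, ha⟩ := hA'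
  obtain ⟨b, hb⟩ := hB'
  rw [hA.measure_eq_iSup_isCompact volume, hB.measure_eq_iSup_isCompact volume]
  simp only [iSup_and']
  refine ENNReal.biSup_add_biSup_le' (p := fun K => K ⊆ A ∧ IsCompact K)
    (q := fun K => K ⊆ B ∧ IsCompact K) ⟨∅, by simp⟩ ⟨∅, by simp⟩ ?_
  rintro K ⟨hKA, hK⟩ M ⟨hMB, hM⟩
  -- The approximating compact sets may be empty; inserting `a` and `b` repairs this.
  refine le_trans ?_ (volume_add_volume_le_of_isCompact (hK.insert a) (hM.insert b)
    (Set.insert_nonempty _ _) (Set.insert_nonempty _ _) (S := S) ?_)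
  · gcongr <;> exact Set.subset_insert _ _
  · exact fun x hx y hy => h x (Set.insert_subset ha hKA hx) y (Set.insert_subset hb hMB hy)

/-- Prékopa–Leindler on the line for functions with supremum one, in additive form. -/
lemma lintegral_add_lintegral_le {f g h : ℝ → ℝ≥0∞} (hf : Measurable f) (hg : Measurable g)
    (hh : Measurable h) (hf1 : ⨆ x, f x = 1) (hg1 : ⨆ x, g x = 1)
    (H : ∀ x y, f x * g y ≤ h ((1 / 2 : ℝ) * (x + y)) ^ 2) :
    (∫⁻ x, f x) + (∫⁻ x, g x) ≤ 2 * ∫⁻ x, h x := by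
  have hfle : ∀ x, f x ≤ 1 := fun x => hf1 ▸ le_iSup f x
  have hgle : ∀ x, g x ≤ 1 := fun x => hg1 ▸ le_iSup g x
  -- Truncation makes `h` finite, as the real-valued layer-cake formula needs; since `f, g ≤ 1`, the
  -- hypothesis survives.
  set h' : ℝ → ℝ≥0∞ := fun x => min (h x) 1
  have hh' : Measurable h' := hh.min measurable_const
  have hh'1 : ∀ x, h' x ≤ 1 := fun x => min_le_right _ _
  have H' : ∀ x y, f x * g y ≤ h' ((1 / 2 : ℝ) * (x + y)) ^ 2 := by
    intro x y
    rcases le_total (h ((1 / 2 : ℝ) * (x + y))) 1 with h1 | h1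
    · exact (H x y).trans_eq (by rw [← min_eq_left h1])
    · have h2 : h' ((1 / 2 : ℝ) * (x + y)) = 1 := min_eq_right h1
      rw [h2, one_pow]
      exact mul_le_one' (hfle x) (hgle y)
  have cake : ∀ u : ℝ → ℝ≥0∞, Measurable u → (∀ x, u x ≤ 1) →
      ∫⁻ x, u x = ∫⁻ t in Set.Ioi (0 : ℝ), volume {x | ENNReal.ofReal t < u x} := by
    intro u hu hu1
    have hne : ∀ x, u x ≠ ∞ := fun x => ((hu1 x).trans_lt ENNReal.one_lt_top).ne
    have := lintegral_eq_lintegral_meas_lt (μ := volume) (f := fun x => (u x).toReal)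
      (Filter.Eventually.of_forall fun x => ENNReal.toReal_nonneg) hu.ennreal_toReal.aemeasurable
    simp only [ENNReal.ofReal_toReal (hne _)] at this
    rw [this]
    refine setLIntegral_congr_fun measurableSet_Ioi fun t ht => ?_
    simp only [ENNReal.ofReal_lt_iff_lt_toReal (le_of_lt ht) (hne _)]
  have hle : ∫⁻ x, h' x ≤ ∫⁻ x, h x := lintegral_mono fun x => min_le_left _ _
  refine le_trans ?_ (mul_le_mul_right hle 2)
  have hmeas : ∀ u : ℝ → ℝ≥0∞, Measurable fun t : ℝ => volume {x | ENNReal.ofReal t < u x} := by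
    intro u
    refine Antitone.measurable fun s t hst => measure_mono fun x hx => ?_
    exact (ENNReal.ofReal_le_ofReal hst).trans_lt hx
  rw [cake f hf hfle, cake g hg hgle, cake h' hh' hh'1, ← lintegral_add_left (hmeas f),
    ← lintegral_const_mul _ (hmeas h')]
  refine setLIntegral_mono ((hmeas h').const_mul _) fun t ht => ?_
  rcases lt_or_ge t 1 with ht1 | ht1
  · have ht1' : ENNReal.ofReal t < 1 := by simpa using ht1
    -- Both superlevel sets are nonempty for every `t < 1` because both suprema equal one.
    refine volume_add_volume_le (measurableSet_lt measurable_const hf)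
      (measurableSet_lt measurable_const hg) ?_ ?_ ?_
    · exact lt_iSup_iff.1 (hf1 ▸ ht1')
    · exact lt_iSup_iff.1 (hg1 ▸ ht1')
    · intro a ha b hb
      have h1 : ENNReal.ofReal t * ENNReal.ofReal t < f a * g b :=
        ENNReal.mul_lt_mul ha hb
      by_contra hcon
      have h2 : h' ((1 / 2 : ℝ) * (a + b)) ≤ ENNReal.ofReal t := not_lt.1 hcon
      have h3 := (h1.trans_le (H' a b)).trans_le (pow_le_pow_left' h2 2)
      rw [sq] at h3
      exact lt_irrefl _ h3
  · have : ∀ u : ℝ → ℝ≥0∞, (∀ x, u x ≤ 1) → {x | ENNReal.ofReal t < u x} = ∅ := by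
      intro u hu
      ext x
      simpa using (hu x).trans (by simpa using ht1)
    simp [this f hfle, this g hgle]

lemma four_mul_mul_le_add_sq (a b : ℝ≥0∞) : 4 * (a * b) ≤ (a + b) ^ 2 := by
  rcases eq_or_ne a ∞ with rfl | ha
  · simp
  rcases eq_or_ne b ∞ with rfl | hb
  · simp
  lift a to NNReal using ha
  lift b to NNReal using hb
  norm_cast
  rw [← NNReal.coe_le_coe]
  push_cast
  nlinarith [sq_nonneg ((a : ℝ) - b)]

/-- Dividing `f`, `g`, `h` by `s`, `t`, `√(st)` reduces to suprema one; AM–GM then turns the sum of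
integrals into a product. -/
lemma lintegral_mul_lintegral_le_of_iSup_ne_top {f g h : ℝ → ℝ≥0∞} (hf : Measurable f)
    (hg : Measurable g) (hh : Measurable h) (hf1 : ⨆ x, f x ≠ ∞) (hg1 : ⨆ x, g x ≠ ∞)
    (H : ∀ x y, f x * g y ≤ h ((1 / 2 : ℝ) * (x + y)) ^ 2) :
    (∫⁻ x, f x) * (∫⁻ x, g x) ≤ (∫⁻ x, h x) ^ 2 := by
  set s := ⨆ x, f x
  set t := ⨆ x, g x
  rcases eq_or_ne s 0 with hs | hs
  · have : ∀ x, f x = 0 := fun x => by simpa using (le_iSup f x).trans hs.le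
    simp [this]
  rcases eq_or_ne t 0 with ht | ht
  · have : ∀ x, g x = 0 := fun x => by simpa using (le_iSup g x).trans ht.le
    simp [this]
  set r : ℝ≥0∞ := (s * t) ^ (1 / 2 : ℝ)
  have hr2 : r ^ 2 = s * t := by
    rw [← ENNReal.rpow_natCast, ← ENNReal.rpow_mul]; norm_num
  have hst : s * t ≠ 0 := mul_ne_zero hs ht
  have hst' : s * t ≠ ∞ := ENNReal.mul_ne_top hf1 hg1
  have key := lintegral_add_lintegral_le (f := fun x => s⁻¹ * f x) (g := fun x => t⁻¹ * g x)
    (h := fun x => r⁻¹ * h x) (hf.const_mul _) (hg.const_mul _) (hh.const_mul _)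
    (by rw [← ENNReal.mul_iSup]; exact ENNReal.inv_mul_cancel hs hf1)
    (by rw [← ENNReal.mul_iSup]; exact ENNReal.inv_mul_cancel ht hg1)
    (by
      intro x y
      rw [mul_pow, ← ENNReal.inv_pow, hr2, ENNReal.mul_inv (Or.inl hs) (Or.inl hf1)]
      calc s⁻¹ * f x * (t⁻¹ * g y) = s⁻¹ * t⁻¹ * (f x * g y) := by ring
        _ ≤ _ := by gcongr; exact H x y)
  rw [lintegral_const_mul _ hf, lintegral_const_mul _ hg, lintegral_const_mul _ hh] at key
  have key2 := (four_mul_mul_le_add_sq _ _).trans (pow_le_pow_left' key 2)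
  have key3 : 4 * ((s * t)⁻¹ * ((∫⁻ x, f x) * ∫⁻ x, g x)) ≤
      4 * ((s * t)⁻¹ * (∫⁻ x, h x) ^ 2) := by
    refine le_trans (le_of_eq ?_) (key2.trans (le_of_eq ?_))
    · rw [ENNReal.mul_inv (Or.inl hs) (Or.inl hf1)]; ring
    · rw [mul_pow, mul_pow, ← ENNReal.inv_pow, hr2]; norm_num
  rwa [ENNReal.mul_le_mul_iff_right (by norm_num) (by norm_num),
    ENNReal.mul_le_mul_iff_right (ENNReal.inv_ne_zero.2 hst') (ENNReal.inv_ne_top.2 hst)] at key3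

/-- The Prékopa–Leindler inequality on the line, for the midpoint. -/
lemma lintegral_mul_lintegral_le_sq_real {f g h : ℝ → ℝ≥0∞} (hf : Measurable f)
    (hg : Measurable g) (hh : Measurable h)
    (H : ∀ x y, f x * g y ≤ h ((1 / 2 : ℝ) * (x + y)) ^ 2) :
    (∫⁻ x, f x) * (∫⁻ x, g x) ≤ (∫⁻ x, h x) ^ 2 := by
  have trunc : ∀ u : ℝ → ℝ≥0∞, Measurable u →
      ∫⁻ x, u x = ⨆ k : ℕ, ∫⁻ x, min (u x) k := by
    intro u hu
    rw [← lintegral_iSup (fun k => hu.min measurable_const)]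
    · congr with x
      rw [← inf_iSup_eq (f := fun k : ℕ => (k : ℝ≥0∞)), ENNReal.iSup_natCast, inf_top_eq]
    · exact fun i j hij x => min_le_min le_rfl (by exact_mod_cast hij)
  have mono : ∀ u : ℝ → ℝ≥0∞, Monotone fun k : ℕ => ∫⁻ x, min (u x) k := fun u i j hij =>
    lintegral_mono fun x => min_le_min le_rfl (by exact_mod_cast hij)
  rw [trunc f hf, trunc g hg, ENNReal.iSup_mul]
  simp_rw [ENNReal.mul_iSup]
  refine iSup_le fun i => iSup_le fun j => ?_
  obtain ⟨k, hik, hjk⟩ : ∃ k, i ≤ k ∧ j ≤ k := ⟨max i j, le_max_left i j, le_max_right i j⟩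
  refine (mul_le_mul' (mono f hik) (mono g hjk)).trans ?_
  have bdd : ∀ u : ℝ → ℝ≥0∞, ⨆ x, min (u x) (k : ℝ≥0∞) ≠ ∞ := fun u =>
    ((iSup_le fun x => min_le_right _ _).trans_lt (ENNReal.natCast_lt_top k)).ne
  exact lintegral_mul_lintegral_le_of_iSup_ne_top (hf.min measurable_const)
    (hg.min measurable_const) hh (bdd f) (bdd g) fun x y =>
      (mul_le_mul' (min_le_left _ _) (min_le_left _ _)).trans (H x y)

/-- The Prékopa–Leindler inequality on `ℝⁿ`, for the midpoint. -/
theorem lintegral_mul_lintegral_le_sq (n : ℕ) {f g h : (Fin n → ℝ) → ℝ≥0∞} (hf : Measurable f)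
    (hg : Measurable g) (hh : Measurable h)
    (H : ∀ x y, f x * g y ≤ h ((1 / 2 : ℝ) • (x + y)) ^ 2) :
    (∫⁻ x, f x) * (∫⁻ x, g x) ≤ (∫⁻ x, h x) ^ 2 := by
  induction n with
  | zero =>
    have : ∀ u : (Fin 0 → ℝ) → ℝ≥0∞, ∫⁻ x, u x = u 0 := by
      intro u
      rw [volume_pi, Measure.pi_of_empty _ 0, lintegral_dirac]
    rw [this, this, this]
    simpa using H 0 0
  | succ n ih =>
    set e := (MeasurableEquiv.piFinSuccAbove (fun _ : Fin (n + 1) => ℝ) 0).symm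
    have he : MeasurePreserving e :=
      (volume_preserving_piFinSuccAbove (fun _ : Fin (n + 1) => ℝ) 0).symm _
    have split : ∀ u : (Fin (n + 1) → ℝ) → ℝ≥0∞, Measurable u →
        ∫⁻ x, u x = ∫⁻ a : ℝ, ∫⁻ y : Fin n → ℝ, u (e (a, y)) := by
      intro u hu
      rw [← he.lintegral_comp hu, Measure.volume_eq_prod]
      exact lintegral_prod _ (hu.comp e.measurable).aemeasurable
    have hmeas : ∀ u : (Fin (n + 1) → ℝ) → ℝ≥0∞, Measurable u →
        Measurable fun p : ℝ × (Fin n → ℝ) => u (e p) := fun u hu => hu.comp e.measurable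
    have hadd : ∀ (a b : ℝ) (x y : Fin n → ℝ), (1 / 2 : ℝ) • (e (a, x) + e (b, y)) =
        e ((1 / 2 : ℝ) * (a + b), (1 / 2 : ℝ) • (x + y)) := by
      intro a b x y
      ext i
      refine Fin.cases ?_ (fun i => ?_) i <;>
        simp [e, MeasurableEquiv.piFinSuccAbove, Fin.insertNthEquiv, mul_add]
    rw [split f hf, split g hg, split h hh]
    -- The fibre integrals satisfy the one-dimensional hypothesis by induction.
    refine lintegral_mul_lintegral_le_sq_real (hmeas f hf).lintegral_prod_right'
      (hmeas g hg).lintegral_prod_right' (hmeas h hh).lintegral_prod_right' fun a b => ?_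
    refine ih ((hmeas f hf).comp measurable_prodMk_left) ((hmeas g hg).comp measurable_prodMk_left)
      ((hmeas h hh).comp measurable_prodMk_left) fun x y => ?_
    simpa only [Function.comp, ← hadd] using H (e (a, x)) (e (b, y))

/-- The multiplicative Brunn–Minkowski inequality, for the midpoint. -/
theorem volume_mul_volume_le_sq {n : ℕ} {A B S : Set (EuclideanSpace ℝ (Fin n))}
    (hA : MeasurableSet A) (hB : MeasurableSet B) (hS : MeasurableSet S)
    (h : ∀ a ∈ A, ∀ b ∈ B, (1 / 2 : ℝ) • (a + b) ∈ S) :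
    volume A * volume B ≤ volume S ^ 2 := by
  have hp := PiLp.volume_preserving_toLp (Fin n)
  have hm : Measurable (WithLp.toLp 2 : (Fin n → ℝ) → EuclideanSpace ℝ (Fin n)) := hp.measurable
  rw [← hp.measure_preimage hA.nullMeasurableSet, ← hp.measure_preimage hB.nullMeasurableSet,
    ← hp.measure_preimage hS.nullMeasurableSet, ← lintegral_indicator_one (hm hA),
    ← lintegral_indicator_one (hm hB), ← lintegral_indicator_one (hm hS)]
  refine lintegral_mul_lintegral_le_sq n (measurable_one.indicator (hm hA))
    (measurable_one.indicator (hm hB)) (measurable_one.indicator (hm hS)) fun x y => ?_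
  by_cases hx : WithLp.toLp 2 x ∈ A
  · by_cases hy : WithLp.toLp 2 y ∈ B
    · have := h _ hx _ hy
      rw [← WithLp.toLp_add, ← WithLp.toLp_smul, ← Set.mem_preimage] at this
      rw [Set.indicator_of_mem this]
      simp [hx, hy]
    · simp [hy]
  · simp [hx]

/-! ### Symmetric bodies, their gauge, and a direction of small width. -/

variable {n : ℕ} {K : Set (EuclideanSpace ℝ (Fin n))}

lemma IsSymmConvexBody.mem_nhds_zero (hK : IsSymmConvexBody K) : K ∈ 𝓝 0 := by
  obtain ⟨z, hz⟩ := hK.interior_nonempty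
  have hneg : -K = K := by
    ext x
    exact ⟨fun h => by simpa using hK.neg_mem _ h, fun h => hK.neg_mem x h⟩
  have hz' : -z ∈ interior K := by
    have h := (Homeomorph.neg (EuclideanSpace ℝ (Fin n))).preimage_interior K
    rw [show Homeomorph.neg (EuclideanSpace ℝ (Fin n)) ⁻¹' K = K from hneg] at h
    rw [← h]
    simpa using hz
  rw [mem_nhds_iff]
  refine ⟨interior K, interior_subset, isOpen_interior, ?_⟩
  have := hK.convex.interior hz hz' (a := 1 / 2) (b := 1 / 2) (by norm_num) (by norm_num)
    (by norm_num)
  simpa using this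

lemma IsSymmConvexBody.zero_mem (hK : IsSymmConvexBody K) : (0 : EuclideanSpace ℝ (Fin n)) ∈ K :=
  mem_of_mem_nhds hK.mem_nhds_zero

lemma IsSymmConvexBody.absorbent (hK : IsSymmConvexBody K) : Absorbent ℝ K :=
  absorbent_nhds_zero hK.mem_nhds_zero

lemma IsSymmConvexBody.gauge_le_one_iff (hK : IsSymmConvexBody K) {x : EuclideanSpace ℝ (Fin n)} :
    gauge K x ≤ 1 ↔ x ∈ K := by
  rw [gauge_le_one_iff_mem_closure hK.convex hK.mem_nhds_zero, hK.isCompact.isClosed.closure_eq]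

lemma IsSymmConvexBody.mem_smul_of_gauge_le (hK : IsSymmConvexBody K)
    {x : EuclideanSpace ℝ (Fin n)} {s : ℝ} (hs : 0 < s) (hx : gauge K x ≤ s) : x ∈ s • K := by
  rw [Set.mem_smul_set_iff_inv_smul_mem₀ hs.ne', ← hK.gauge_le_one_iff,
    gauge_smul_of_nonneg (inv_nonneg.2 hs.le), smul_eq_mul, inv_mul_le_iff₀ hs, mul_one]
  exact hx

lemma IsTwoConvex.gauge_midpoint_le (hK : IsSymmConvexBody K) {α : ℝ} (h : IsTwoConvex K α)
    {x y : EuclideanSpace ℝ (Fin n)} (hx : x ∈ K) (hy : y ∈ K) {ε : ℝ} (hε : 0 < ε) (hε2 : ε ≤ 2)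
    (hxy : ε ≤ gauge K (x - y)) : gauge K ((1 / 2 : ℝ) • (x + y)) ≤ 1 - α * ε ^ 2 := by
  -- The real infimum bounds its members only for a set bounded below; the triangle inequality gives
  -- the bound `0`.
  have hbdd : BddBelow {d : ℝ | ∃ x y : EuclideanSpace ℝ (Fin n), gauge K x ≤ 1 ∧ gauge K y ≤ 1 ∧
      ε ≤ gauge K (x - y) ∧ d = 1 - gauge K ((1 / 2 : ℝ) • (x + y))} := by
    refine ⟨0, ?_⟩
    rintro d ⟨a, b, ha, hb, -, rfl⟩
    have h1 := gauge_add_le hK.convex hK.absorbent a b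
    rw [gauge_smul_of_nonneg (by norm_num), smul_eq_mul]
    linarith
  have h1 := h ε hε hε2
  have h2 : modulusOfConvexity K ε ≤ 1 - gauge K ((1 / 2 : ℝ) • (x + y)) :=
    csInf_le hbdd ⟨x, y, hK.gauge_le_one_iff.2 hx, hK.gauge_le_one_iff.2 hy, hxy, rfl⟩
  linarith

/-- A set that is not large enough to contain a cube of side two has a direction in which its
support function is at most `√n`. -/
lemma IsSymmConvexBody.exists_inner_le_sqrt (hK : IsSymmConvexBody K) (hn : 1 ≤ n)
    (hvol : volume K = 1) : ∃ θ : EuclideanSpace ℝ (Fin n), ‖θ‖ = 1 ∧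
      ∀ x ∈ K, inner ℝ x θ ≤ √n := by
  obtain ⟨z, hzK, hz⟩ : ∃ z : EuclideanSpace ℝ (Fin n), z ∉ K ∧ ‖z‖ ≤ √n := by
    by_contra! hcon
    have hp := PiLp.volume_preserving_toLp (Fin n)
    have hsub : Set.Icc (fun _ : Fin n => (-1 : ℝ)) (fun _ => 1) ⊆ WithLp.toLp 2 ⁻¹' K := by
      intro x hx
      by_contra hxK
      refine absurd (hcon _ hxK) (not_lt.2 ?_)
      rw [EuclideanSpace.norm_eq]
      refine Real.sqrt_le_sqrt ?_
      calc ∑ i, ‖x i‖ ^ 2 ≤ ∑ _i : Fin n, (1 : ℝ) := by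
            refine Finset.sum_le_sum fun i _ => ?_
            have := hx.1 i
            have := hx.2 i
            simp only [Real.norm_eq_abs, sq_abs]
            nlinarith
        _ = n := by simp
    have h1 := measure_mono (μ := volume) hsub
    rw [hp.measure_preimage hK.isCompact.measurableSet.nullMeasurableSet, hvol,
      Real.volume_Icc_pi] at h1
    norm_num at h1
    have h2 : (1 : ℝ≥0∞) < 2 ^ n := one_lt_pow₀ (by norm_num) (by omega)
    exact absurd h1 (not_le.2 h2)
  obtain ⟨f, u, hfK, hfz⟩ := geometric_hahn_banach_closed_point hK.convex hK.isCompact.isClosed hzK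
  set v := (InnerProductSpace.toDual ℝ (EuclideanSpace ℝ (Fin n))).symm f
  have hv : ∀ x, inner ℝ x v = f x := fun x => by
    rw [real_inner_comm]; exact InnerProductSpace.toDual_symm_apply
  have hu : 0 < u := by simpa using hfK 0 hK.zero_mem
  have hv0 : v ≠ 0 := by
    intro h0
    have := hv z
    rw [h0, inner_zero_right] at this
    linarith
  have hvn : 0 < ‖v‖ := norm_pos_iff.2 hv0
  refine ⟨‖v‖⁻¹ • v, norm_smul_inv_norm hv0, fun x hx => ?_⟩
  rw [inner_smul_right, inv_mul_le_iff₀ hvn]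
  calc inner ℝ x v ≤ inner ℝ z v := by rw [hv, hv]; exact ((hfK x hx).trans hfz).le
    _ ≤ ‖z‖ * ‖v‖ := real_inner_le_norm z v
    _ ≤ ‖v‖ * √n := by rw [mul_comm]; gcongr

lemma IsSymmConvexBody.inner_le_mul_gauge (hK : IsSymmConvexBody K)
    {θ : EuclideanSpace ℝ (Fin n)} {r : ℝ} (hr : 0 < r) (h : ∀ x ∈ K, inner ℝ x θ ≤ r)
    (x : EuclideanSpace ℝ (Fin n)) : inner ℝ x θ ≤ r * gauge K x := by
  rw [mul_comm, ← div_le_iff₀ hr]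
  refine le_of_forall_gt fun s hs => ?_
  obtain ⟨b, hb0, hbs, y, hy, rfl⟩ := exists_lt_of_gauge_lt hK.absorbent hs
  refine lt_of_le_of_lt ?_ hbs
  simp only [inner_smul_left, RCLike.conj_to_real]
  rw [div_le_iff₀ hr]
  exact mul_le_mul_of_nonneg_left (h y hy) hb0.le

lemma IsSymmConvexBody.one_le_two_mul_volume_halfspace (hK : IsSymmConvexBody K)
    (hvol : volume K = 1) (θ : EuclideanSpace ℝ (Fin n)) :
    1 ≤ 2 * volume (K ∩ {x | inner ℝ x θ ≤ 0}) := by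
  set A := K ∩ {x | inner ℝ x θ ≤ 0}
  have hsub : K ⊆ A ∪ -A := by
    intro x hx
    rcases le_total (inner ℝ x θ) 0 with h | h
    · exact Or.inl ⟨hx, h⟩
    · exact Or.inr ⟨hK.neg_mem x hx, by simpa using h⟩
  calc (1 : ℝ≥0∞) = volume K := hvol.symm
    _ ≤ volume A + volume (-A) := (measure_mono hsub).trans (measure_union_le _ _)
    _ = 2 * volume A := by rw [Measure.measure_neg, two_mul]

/-! ### Gaussian tails and second moments. -/

/-- The Gaussian tail of a linear functional bounded by `√n` on a 2-convex body. -/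
lemma IsTwoConvex.volume_le_inner_le (hK : IsSymmConvexBody K) (hn : 1 ≤ n) (hvol : volume K = 1)
    {α : ℝ} (h2 : IsTwoConvex K α) {θ : EuclideanSpace ℝ (Fin n)}
    (hθ : ∀ x ∈ K, inner ℝ x θ ≤ √n) {t : ℝ} (ht : 0 < t) :
    volume (K ∩ {x | t ≤ inner ℝ x θ}) ≤ 2 * ENNReal.ofReal (Real.exp (-(2 * α) * t ^ 2)) := by
  have hn0 : (0 : ℝ) < n := by exact_mod_cast hn
  have hr : 0 < √(n : ℝ) := Real.sqrt_pos.2 hn0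
  rcases lt_or_ge (√(n : ℝ)) t with htr | htr
  · have : K ∩ {x | t ≤ inner ℝ x θ} = ∅ := by
      ext x
      simp only [Set.mem_inter_iff, Set.mem_ofPred_eq, Set.mem_empty_iff_false, iff_false, not_and,
        not_le]
      exact fun hx => (hθ x hx).trans_lt htr
    simp [this]
  have hKm : MeasurableSet K := hK.isCompact.measurableSet
  set A := K ∩ {x : EuclideanSpace ℝ (Fin n) | inner ℝ x θ ≤ 0}
  set B := K ∩ {x : EuclideanSpace ℝ (Fin n) | t ≤ inner ℝ x θ}
  have hA : MeasurableSet A := hKm.inter (measurableSet_le (by fun_prop) (by fun_prop))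
  have hB : MeasurableSet B := hKm.inter (measurableSet_le (by fun_prop) (by fun_prop))
  set ε := t / √(n : ℝ)
  have hε : 0 < ε := div_pos ht hr
  have hε1 : ε ≤ 1 := (div_le_one hr).2 htr
  -- Unlike the smaller factor `1 - αε²`, this one is always positive, and its power `2n` is exactly
  -- `exp(-2αt²)`.
  set s := Real.exp (-(α * ε ^ 2))
  have hs : 0 < s := Real.exp_pos _
  have hmid : ∀ a ∈ A, ∀ b ∈ B, (1 / 2 : ℝ) • (a + b) ∈ s • K := by
    rintro a ⟨haK, ha⟩ b ⟨hbK, hb⟩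
    refine hK.mem_smul_of_gauge_le hs ?_
    rw [add_comm a b]
    refine (h2.gauge_midpoint_le hK hbK haK hε (hε1.trans one_le_two) ?_).trans ?_
    · have h3 := hK.inner_le_mul_gauge hr hθ (b - a)
      rw [inner_sub_left] at h3
      simp only [Set.mem_ofPred_eq] at ha hb
      rw [div_le_iff₀ hr]
      linarith
    · have := Real.add_one_le_exp (-(α * ε ^ 2))
      linarith
  have hBM := volume_mul_volume_le_sq hA hB (hKm.const_smul₀ s) hmid
  have hpow : (s ^ n) ^ 2 = Real.exp (-(2 * α) * t ^ 2) := by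
    have : (n : ℝ) * ε ^ 2 = t ^ 2 := by
      rw [div_pow, Real.sq_sqrt hn0.le]; field_simp
    rw [← Real.exp_nat_mul, ← Real.exp_nat_mul, ← this]
    congr 1
    push_cast
    ring
  have hvs : volume (s • K) ^ 2 = ENNReal.ofReal (Real.exp (-(2 * α) * t ^ 2)) := by
    rw [Measure.addHaar_smul, hvol, mul_one, finrank_euclideanSpace_fin,
      abs_of_pos (pow_pos hs n), ← ENNReal.ofReal_pow (pow_pos hs n).le, hpow]
  rw [hvs] at hBM
  calc volume B = 1 * volume B := (one_mul _).symm
    _ ≤ 2 * volume A * volume B := by gcongr; exact hK.one_le_two_mul_volume_halfspace hvol θ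
    _ = 2 * (volume A * volume B) := mul_assoc _ _ _
    _ ≤ _ := by gcongr

lemma IsTwoConvex.volume_le_inner_sq_le (hK : IsSymmConvexBody K) (hn : 1 ≤ n)
    (hvol : volume K = 1) {α : ℝ} (h2 : IsTwoConvex K α)
    {θ : EuclideanSpace ℝ (Fin n)} (hθ : ∀ x ∈ K, inner ℝ x θ ≤ √n) {t : ℝ} (ht : 0 < t) :
    volume (K ∩ {x | t ≤ (inner ℝ x θ) ^ 2}) ≤ 4 * ENNReal.ofReal (Real.exp (-(2 * α) * t)) := by
  have hθ' : ∀ x ∈ K, inner ℝ x (-θ) ≤ √n := fun x hx => by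
    simpa using hθ (-x) (hK.neg_mem x hx)
  have hst : 0 < √t := Real.sqrt_pos.2 ht
  have h1 := h2.volume_le_inner_le hK hn hvol hθ hst
  have h3 := h2.volume_le_inner_le hK hn hvol hθ' hst
  rw [Real.sq_sqrt ht.le] at h1 h3
  have hsub : K ∩ {x | t ≤ (inner ℝ x θ) ^ 2} ⊆
      (K ∩ {x | √t ≤ inner ℝ x θ}) ∪ (K ∩ {x | √t ≤ inner ℝ x (-θ)}) := by
    rintro x ⟨hx, hxt⟩
    have hxt' : √t ≤ |inner ℝ x θ| := by
      rw [← Real.sqrt_sq_eq_abs]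
      exact Real.sqrt_le_sqrt hxt
    rcases le_abs.1 hxt' with h | h
    · exact Or.inl ⟨hx, h⟩
    · exact Or.inr ⟨hx, by simpa using h⟩
  refine (measure_mono hsub).trans ((measure_union_le _ _).trans ((add_le_add h1 h3).trans_eq ?_))
  rw [← add_mul]; norm_num

/-- A functional bounded by `√n` on a 2-convex body of volume one has second moment at most
`2 / α`. -/
lemma IsTwoConvex.integral_inner_sq_le (hK : IsSymmConvexBody K) (hn : 1 ≤ n)
    (hvol : volume K = 1) {α : ℝ} (hα : 0 < α) (h2 : IsTwoConvex K α)
    {θ : EuclideanSpace ℝ (Fin n)} (hθ : ∀ x ∈ K, inner ℝ x θ ≤ √n) :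
    ∫ x in K, (inner ℝ x θ) ^ 2 ≤ 2 / α := by
  have hcont : Continuous fun x : EuclideanSpace ℝ (Fin n) => (inner ℝ x θ) ^ 2 := by fun_prop
  rw [integral_eq_lintegral_of_nonneg_ae (Filter.Eventually.of_forall fun x => sq_nonneg _)
    hcont.aestronglyMeasurable]
  refine ENNReal.toReal_le_of_le_ofReal (by positivity) ?_
  rw [lintegral_eq_lintegral_meas_le _ (Filter.Eventually.of_forall fun x => sq_nonneg _)
    hcont.aemeasurable]
  have hmeas : Measurable fun t : ℝ => 4 * ENNReal.ofReal (Real.exp (-(2 * α) * t)) := by fun_prop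
  have hneg : -(2 * α) < 0 := by linarith
  calc _ ≤ ∫⁻ t in Set.Ioi (0 : ℝ), 4 * ENNReal.ofReal (Real.exp (-(2 * α) * t)) := by
        refine setLIntegral_mono hmeas fun t ht => ?_
        rw [Measure.restrict_apply (measurableSet_le measurable_const hcont.measurable),
          Set.inter_comm]
        exact h2.volume_le_inner_sq_le hK hn hvol hθ ht
    _ = 4 * ENNReal.ofReal (∫ t in Set.Ioi (0 : ℝ), Real.exp (-(2 * α) * t)) := by
        rw [lintegral_const_mul _ (by fun_prop), ofReal_integral_eq_lintegral_ofReal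
          (integrableOn_exp_mul_Ioi hneg 0)
          (Filter.Eventually.of_forall fun t => (Real.exp_pos _).le)]
    _ = ENNReal.ofReal (2 / α) := by
        rw [integral_exp_mul_Ioi hneg, ← ENNReal.ofReal_ofNat 4,
          ← ENNReal.ofReal_mul (by norm_num)]
        congr 1
        simp
        field_simp
        norm_num

/-! ### Large hyperplane sections. -/

/-- If the part of a set in a slab of half-width `t` has volume more than `2 t b`, then the set
has a hyperplane section of volume at least `b`. -/
lemma exists_hyperplane_section_ge (hn : 1 ≤ n) (hKm : MeasurableSet K)
    {θ : EuclideanSpace ℝ (Fin n)} (hθ : ‖θ‖ = 1) {t b : ℝ} (ht : 0 < t) (hb : 0 < b)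
    (hslab : ENNReal.ofReal (2 * t * b) < volume (K ∩ {x | (inner ℝ x θ) ^ 2 < t ^ 2})) :
    ∃ H : AffineSubspace ℝ (EuclideanSpace ℝ (Fin n)),
      (H : Set (EuclideanSpace ℝ (Fin n))).Nonempty ∧
      Module.finrank ℝ H.direction + 1 = n ∧
      ENNReal.ofReal b ≤ μHE[n - 1] (K ∩ (H : Set (EuclideanSpace ℝ (Fin n)))) := by
  have hθ0 : θ ≠ 0 := by rintro rfl; simp at hθ
  obtain ⟨m, rfl⟩ : ∃ m, n = m + 1 := ⟨n - 1, by omega⟩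
  have : Fact (Module.finrank ℝ (EuclideanSpace ℝ (Fin (m + 1))) = m + 1) :=
    ⟨finrank_euclideanSpace_fin⟩
  by_contra! hcon
  set S := K ∩ {x : EuclideanSpace ℝ (Fin (m + 1)) | (inner ℝ x θ) ^ 2 < t ^ 2}
  have hS : MeasurableSet S := hKm.inter (measurableSet_lt (by fun_prop) (by fun_prop))
  -- Fubini over the hyperplanes orthogonal to `θ`; slices at heights outside `(-t, t)` are empty.
  have key := EuclideanGeometry.euclideanHausdorffMeasure_eq_lintegral
    (0 : EuclideanSpace ℝ (Fin (m + 1))) hθ0 hS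
  rw [InnerProductSpace.euclideanHausdorffMeasure_eq_volume, ← ofReal_norm, hθ,
    ENNReal.ofReal_one, one_mul, finrank_euclideanSpace_fin] at key
  rw [key] at hslab
  refine absurd hslab (not_lt.2 ?_)
  calc _ ≤ ∫⁻ x : ℝ, (Set.Ioo (-t) t).indicator (fun _ => ENNReal.ofReal b) x := by
        refine lintegral_mono fun x => ?_
        by_cases hx : x ∈ Set.Ioo (-t) t
        · rw [Set.indicator_of_mem hx]
          refine (measure_mono (Set.inter_subset_inter_left _ Set.inter_subset_left)).trans
            (hcon _ (AffineSubspace.mk'_nonempty _ _) ?_).le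
          rw [AffineSubspace.direction_mk', Submodule.finrank_orthogonal_span_singleton (n := m) hθ0]
        · rw [Set.indicator_of_notMem hx]
          refine le_of_eq (measure_mono_null ?_ measure_empty)
          rintro y ⟨⟨-, hy⟩, hyH⟩
          refine hx (abs_lt.1 ?_)
          rw [SetLike.mem_coe, AffineSubspace.mem_mk', Submodule.mem_orthogonal_singleton_iff_inner_left]
            at hyH
          have hy' : inner ℝ y θ = x := by
            simpa [inner_sub_left, inner_smul_left, hθ, sub_eq_zero] using hyH
          simp only [Set.mem_ofPred_eq, hy'] at hy
          exact (abs_lt_of_sq_lt_sq hy ht.le)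
    _ = ENNReal.ofReal (2 * t * b) := by
        rw [lintegral_indicator_const measurableSet_Ioo, Real.volume_Ioo,
          ← ENNReal.ofReal_mul hb.le]
        congr 1
        ring

/-! ### Linear invariance and isotropic position. -/

lemma IsSymmConvexBody.image (hK : IsSymmConvexBody K)
    (T : EuclideanSpace ℝ (Fin n) ≃ₗ[ℝ] EuclideanSpace ℝ (Fin n)) :
    IsSymmConvexBody (T '' K) where
  convex := hK.convex.linear_image T.toLinearMap
  isCompact := hK.isCompact.image T.toContinuousLinearEquiv.continuous
  interior_nonempty := by
    have h := T.toContinuousLinearEquiv.toHomeomorph.image_interior K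
    change T '' interior K = interior (T '' K) at h
    rw [← h]
    exact hK.interior_nonempty.image T
  neg_mem := by
    rintro _ ⟨x, hx, rfl⟩
    exact ⟨-x, hK.neg_mem x hx, map_neg T x⟩

lemma gauge_image_apply (T : EuclideanSpace ℝ (Fin n) ≃ₗ[ℝ] EuclideanSpace ℝ (Fin n))
    (x : EuclideanSpace ℝ (Fin n)) : gauge (T '' K) (T x) = gauge K x := by
  simp only [gauge_def', ← map_smul, T.injective.mem_set_image]

lemma modulusOfConvexity_image
    (T : EuclideanSpace ℝ (Fin n) ≃ₗ[ℝ] EuclideanSpace ℝ (Fin n)) (ε : ℝ) :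
    modulusOfConvexity (T '' K) ε = modulusOfConvexity K ε := by
  unfold modulusOfConvexity
  congr 1
  ext d
  constructor
  · rintro ⟨x, y, h⟩
    obtain ⟨x, rfl⟩ := T.surjective x
    obtain ⟨y, rfl⟩ := T.surjective y
    rw [← map_add, ← map_sub, ← map_smul] at h
    simp only [gauge_image_apply] at h
    exact ⟨x, y, h⟩
  · rintro ⟨x, y, h⟩
    refine ⟨T x, T y, ?_⟩
    rw [← map_add, ← map_sub, ← map_smul]
    simpa only [gauge_image_apply] using h

lemma IsTwoConvex.image {α : ℝ} (h : IsTwoConvex K α)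
    (T : EuclideanSpace ℝ (Fin n) ≃ₗ[ℝ] EuclideanSpace ℝ (Fin n)) :
    IsTwoConvex (T '' K) α := fun ε hε hε2 => by
  rw [modulusOfConvexity_image]
  exact h ε hε hε2

/-- The matrix of second moments of a set. -/
noncomputable def momentMatrix (K : Set (EuclideanSpace ℝ (Fin n))) : Matrix (Fin n) (Fin n) ℝ :=
  Matrix.of fun i j => ∫ x in K, x i * x j

lemma IsSymmConvexBody.dotProduct_momentMatrix (hK : IsSymmConvexBody K)
    (θ : EuclideanSpace ℝ (Fin n)) :
    θ.ofLp ⬝ᵥ (momentMatrix K *ᵥ θ.ofLp) = ∫ x in K, (inner ℝ x θ) ^ 2 := by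
  have hint : ∀ i j : Fin n, Integrable (fun x : EuclideanSpace ℝ (Fin n) =>
      θ i * (x i * x j * θ j)) (volume.restrict K) := fun i j =>
    (Continuous.continuousOn (by fun_prop)).integrableOn_compact hK.isCompact
  have hexp : ∀ x : EuclideanSpace ℝ (Fin n),
      (inner ℝ x θ) ^ 2 = ∑ i, ∑ j, θ i * (x i * x j * θ j) := by
    intro x
    rw [PiLp.inner_apply, sq, Finset.sum_mul_sum]
    refine Finset.sum_congr rfl fun i _ => Finset.sum_congr rfl fun j _ => ?_
    simp only [RCLike.inner_apply, conj_trivial]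
    ring
  simp_rw [hexp]
  rw [integral_finsetSum _ fun i _ => integrable_finsetSum _ fun j _ => hint i j]
  simp_rw [integral_finsetSum _ fun j _ => hint _ j, integral_const_mul, integral_mul_const]
  simp [dotProduct, Matrix.mulVec, momentMatrix, Finset.mul_sum]

/-- The integrand vanishes only on the null hyperplane `θᗮ`, while `K` has positive volume. -/
lemma IsSymmConvexBody.integral_inner_sq_pos (hK : IsSymmConvexBody K)
    {θ : EuclideanSpace ℝ (Fin n)} (hθ : θ ≠ 0) : 0 < ∫ x in K, (inner ℝ x θ) ^ 2 := by
  have hcont : Continuous fun x : EuclideanSpace ℝ (Fin n) => (inner ℝ x θ) ^ 2 := by fun_prop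
  rw [setIntegral_pos_iff_support_of_nonneg_ae (Filter.Eventually.of_forall fun x => sq_nonneg _)
    (hcont.continuousOn.integrableOn_compact hK.isCompact)]
  have hzero : volume ((ℝ ∙ θ)ᗮ : Set (EuclideanSpace ℝ (Fin n))) = 0 := by
    refine Measure.addHaar_submodule _ _ fun htop => hθ ?_
    have : θ ∈ (ℝ ∙ θ)ᗮ := htop ▸ Submodule.mem_top
    simpa [Submodule.mem_orthogonal_singleton_iff_inner_left] using this
  have hpos : 0 < volume K :=
    (isOpen_interior.measure_pos volume hK.interior_nonempty).trans_le
      (measure_mono interior_subset)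
  have hsub : K ⊆ (Function.support (fun x : EuclideanSpace ℝ (Fin n) => (inner ℝ x θ) ^ 2) ∩ K) ∪
      ((ℝ ∙ θ)ᗮ : Set (EuclideanSpace ℝ (Fin n))) := by
    intro x hx
    by_cases h : inner ℝ x θ = 0
    · exact Or.inr ((Submodule.mem_orthogonal_singleton_iff_inner_left).2 h)
    · exact Or.inl ⟨by simpa using h, hx⟩
  refine hpos.trans_le ((measure_mono hsub).trans ((measure_union_le _ _).trans ?_))
  rw [hzero, add_zero]

lemma IsSymmConvexBody.posDef_momentMatrix (hK : IsSymmConvexBody K) :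
    (momentMatrix K).PosDef := by
  refine .of_dotProduct_mulVec_pos ?_ fun v hv => ?_
  · ext i j
    simp [momentMatrix, mul_comm]
  · have h := hK.dotProduct_momentMatrix (WithLp.toLp 2 v)
    rw [star_trivial]
    refine h ▸ hK.integral_inner_sq_pos ?_
    simpa using hv

lemma setIntegral_image_linearEquiv (hK : MeasurableSet K)
    (T : EuclideanSpace ℝ (Fin n) ≃ₗ[ℝ] EuclideanSpace ℝ (Fin n))
    (g : EuclideanSpace ℝ (Fin n) → ℝ) :
    ∫ x in T '' K, g x = |LinearMap.det (T : EuclideanSpace ℝ (Fin n) →ₗ[ℝ] _)| *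
      ∫ x in K, g (T x) := by
  have h := integral_image_eq_integral_abs_det_fderiv_smul volume hK
    (f := T.toContinuousLinearEquiv) (f' := fun _ => (T.toContinuousLinearEquiv : EuclideanSpace ℝ (Fin n) →L[ℝ] _))
    (fun x _ => T.toContinuousLinearEquiv.hasFDerivAt.hasFDerivWithinAt) T.injective.injOn g
  rw [← integral_const_mul]
  exact h

/-- Every symmetric convex body has a linear image whose second moments are isotropic, up to the
normalization of the volume. -/
lemma IsSymmConvexBody.exists_integral_inner_sq_eq (hK : IsSymmConvexBody K) :
    ∃ T : EuclideanSpace ℝ (Fin n) →ₗ[ℝ] EuclideanSpace ℝ (Fin n), LinearMap.det T ≠ 0 ∧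
      ∀ θ, ∫ x in K, (inner ℝ (T x) θ) ^ 2 = ‖θ‖ ^ 2 := by
  have hM := hK.posDef_momentMatrix
  obtain ⟨B, hB⟩ := CStarAlgebra.nonneg_iff_eq_star_mul_self.mp hM.posSemidef.nonneg
  have hBdet : IsUnit B.det := by
    have h1 := (Matrix.isUnit_iff_isUnit_det _).1 hM.isUnit
    rw [hB, Matrix.det_mul] at h1
    exact isUnit_of_mul_isUnit_right h1
  -- With moment matrix `B*B`, moving the adjoint onto `θ` gives second moment `|B B⁻¹ θ|² = |θ|²`.
  refine ⟨Matrix.toEuclideanLin (B⁻¹)ᴴ, ?_, fun θ => ?_⟩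
  · rw [Matrix.toEuclideanLin, Matrix.toLpLin_eq_toLin, LinearMap.det_toLin, Matrix.det_conjTranspose, star_trivial]
    exact ((Matrix.isUnit_nonsing_inv_det_iff).2 hBdet).ne_zero
  · simp_rw [Matrix.toEuclideanLin_conjTranspose_eq_adjoint, LinearMap.adjoint_inner_left]
    rw [← hK.dotProduct_momentMatrix, hB, Matrix.ofLp_toLpLin, Matrix.toLin'_apply, ← Matrix.mulVec_mulVec,
      Matrix.mulVec_mulVec _ B, Matrix.mul_nonsing_inv _ hBdet, Matrix.one_mulVec,
      Matrix.star_eq_conjTranspose, Matrix.conjTranspose_eq_transpose_of_trivial,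
      Matrix.mulVec_transpose, dotProduct_comm, ← Matrix.dotProduct_mulVec, Matrix.mulVec_mulVec,
      Matrix.mul_nonsing_inv _ hBdet, Matrix.one_mulVec, EuclideanSpace.real_norm_sq_eq]
    simp [dotProduct, sq]

theorem IsSymmConvexBody.exists_hasIsotropicConstant (hK : IsSymmConvexBody K) (hn : 1 ≤ n)
    (hvol : volume K = 1) : ∃ L : ℝ, HasIsotropicConstant K L := by
  obtain ⟨T₀, hdet, hT₀⟩ := hK.exists_integral_inner_sq_eq
  set d := |LinearMap.det T₀|
  have hd : 0 < d := abs_pos.2 hdet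
  -- Scaling by `d^(-1/n)` makes the determinant `±1`, so volume one is kept and `c` becomes the
  -- isotropic constant.
  set c : ℝ := (d⁻¹) ^ ((n : ℝ)⁻¹)
  have hc : 0 < c := Real.rpow_pos_of_pos (inv_pos.2 hd) _
  have hcn : c ^ n = d⁻¹ := Real.rpow_inv_natCast_pow (inv_pos.2 hd).le (by omega)
  have hdet' : |LinearMap.det (c • T₀)| = 1 := by
    rw [LinearMap.det_smul, finrank_euclideanSpace_fin, abs_mul, abs_of_pos (pow_pos hc n), hcn]
    exact inv_mul_cancel₀ hd.ne'
  have hne : LinearMap.det (c • T₀) ≠ 0 := fun h => by simp [h] at hdet'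
  set T := LinearMap.equivOfDetNeZero (c • T₀) hne
  have hTapp : ∀ x, T x = c • T₀ x := fun x => rfl
  have hTdet : |LinearMap.det (T : EuclideanSpace ℝ (Fin n) →ₗ[ℝ] _)| = 1 := hdet'
  refine ⟨c, T, ?_, hc.le, fun θ => ?_⟩
  · have h := Measure.addHaar_image_linearMap volume
      (T : EuclideanSpace ℝ (Fin n) →ₗ[ℝ] EuclideanSpace ℝ (Fin n)) K
    rw [hTdet, hvol, ENNReal.ofReal_one, one_mul] at h
    exact h
  · rw [setIntegral_image_linearEquiv hK.isCompact.measurableSet, hTdet, one_mul, ← hT₀ θ,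
      ← integral_const_mul]
    simp_rw [hTapp, inner_smul_left, mul_pow, conj_trivial]

/-! ### The two bounds. -/

theorem IsTwoConvex.isotropicConstant_le (hK : IsSymmConvexBody K) (hn : 1 ≤ n) {α : ℝ}
    (hα : 0 < α) (h2 : IsTwoConvex K α) {L : ℝ} (hL : HasIsotropicConstant K L) :
    L ≤ 2 / √α := by
  obtain ⟨T, hvol, hL0, hiso⟩ := hL
  obtain ⟨θ, hθ, hθK⟩ := (hK.image T).exists_inner_le_sqrt hn hvol
  have h := (h2.image T).integral_inner_sq_le (hK.image T) hn hvol hα hθK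
  rw [hiso, hθ, one_pow, mul_one] at h
  refine abs_le_of_sq_le_sq' (h.trans ?_) (by positivity) |>.2
  rw [div_pow, Real.sq_sqrt hα.le]
  gcongr
  norm_num

theorem IsTwoConvex.exists_hyperplane_section_ge (hK : IsSymmConvexBody K) (hn : 1 ≤ n)
    (hvol : volume K = 1) {α : ℝ} (hα : 0 < α) (h2 : IsTwoConvex K α) :
    ∃ H : AffineSubspace ℝ (EuclideanSpace ℝ (Fin n)),
      (H : Set (EuclideanSpace ℝ (Fin n))).Nonempty ∧
      Module.finrank ℝ H.direction + 1 = n ∧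
      ENNReal.ofReal (1 / 8 * √α) ≤ μHE[n - 1] (K ∩ (H : Set (EuclideanSpace ℝ (Fin n)))) := by
  obtain ⟨θ, hθ, hθK⟩ := hK.exists_inner_le_sqrt hn hvol
  have hs : 0 < √α := Real.sqrt_pos.2 hα
  -- The tail beyond `t` is at most `4 exp(-9/2) ≤ 4/9`, so the slab has volume at least `5/9`,
  -- above the required `2t · √α/8 = 3/8`.
  set t : ℝ := 3 / 2 / √α
  have ht : 0 < t := by positivity
  have ht2 : t ^ 2 = 9 / 4 / α := by rw [div_pow, Real.sq_sqrt hα.le]; norm_num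
  refine TwoConvexBody.exists_hyperplane_section_ge hn hK.isCompact.measurableSet hθ ht
    (by positivity) ?_
  have htail := h2.volume_le_inner_sq_le hK hn hvol hθK (t := t ^ 2) (by positivity)
  have hexp : Real.exp (-(2 * α) * t ^ 2) ≤ 1 / 9 := by
    have h1 : -(2 * α) * t ^ 2 = -(9 / 2) := by rw [ht2]; field_simp; norm_num
    -- Applied at `9/2`, the linear bound gives only `11/2 < 9`; at half the exponent, squaring
    -- gives `(13/4)² > 9`.
    have h3 := Real.add_one_le_exp (9 / 2 / 2 : ℝ)
    have h4 : Real.exp (9 / 2) = Real.exp (9 / 2 / 2) ^ 2 := by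
      rw [← Real.exp_nat_mul]; norm_num
    rw [h1, Real.exp_neg, ← one_div]
    refine one_div_le_one_div_of_le (by norm_num) ?_
    rw [h4]
    nlinarith
  have htail' : volume (K ∩ {x | t ^ 2 ≤ (inner ℝ x θ) ^ 2}) ≤ ENNReal.ofReal (4 / 9) := by
    refine htail.trans ?_
    rw [← ENNReal.ofReal_ofNat 4, ← ENNReal.ofReal_mul (by norm_num)]
    exact ENNReal.ofReal_le_ofReal (by linarith)
  have hsub : K ⊆ (K ∩ {x | (inner ℝ x θ) ^ 2 < t ^ 2}) ∪
      (K ∩ {x | t ^ 2 ≤ (inner ℝ x θ) ^ 2}) := fun x hx =>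
    (lt_or_ge ((inner ℝ x θ) ^ 2) (t ^ 2)).imp (fun h => ⟨hx, h⟩) (fun h => ⟨hx, h⟩)
  have hsum : 1 ≤ volume (K ∩ {x | (inner ℝ x θ) ^ 2 < t ^ 2}) + ENNReal.ofReal (4 / 9) := by
    rw [← hvol]
    exact (measure_mono hsub).trans ((measure_union_le _ _).trans (by gcongr))
  have hb : 2 * t * (1 / 8 * √α) = 3 / 8 := by
    simp only [t]; field_simp
  rw [hb]
  by_contra! hcon
  have h5 := hsum.trans (add_le_add_left hcon _)
  rw [← ENNReal.ofReal_add (by norm_num) (by norm_num), ENNReal.one_le_ofReal] at h5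
  norm_num at h5

end TwoConvexBody

theorem proposition1 :
    ∃ c C : ℝ, 0 < c ∧ 0 < C ∧
      ∀ (n : ℕ), 1 ≤ n → ∀ (K : Set (EuclideanSpace ℝ (Fin n))) (α : ℝ), 0 < α →
        TwoConvexBody.IsSymmConvexBody K → volume K = 1 → TwoConvexBody.IsTwoConvex K α →
        (∃ H : AffineSubspace ℝ (EuclideanSpace ℝ (Fin n)),
          (H : Set (EuclideanSpace ℝ (Fin n))).Nonempty ∧
          Module.finrank ℝ H.direction + 1 = n ∧
          ENNReal.ofReal (c * √α) ≤
            μHE[n - 1] (K ∩ (H : Set (EuclideanSpace ℝ (Fin n))))) ∧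
        (∃ L : ℝ, TwoConvexBody.HasIsotropicConstant K L) ∧
        (∀ L : ℝ, TwoConvexBody.HasIsotropicConstant K L → L ≤ C / √α) :=
  ⟨1 / 8, 2, by norm_num, by norm_num, fun _ hn _ _ hα hK hvol h2 =>
    ⟨h2.exists_hyperplane_section_ge hK hn hvol hα, hK.exists_hasIsotropicConstant hn hvol,
      fun _ hL => h2.isotropicConstant_le hK hn hα hL⟩⟩
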